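/- Let $G$ be a compact Lie subgroup of $\mathrm{U}(n)$, $n\ge 0$, that contains $zI$ for every $z\in\mathbb{C}$ with $|z|=1$, where $I$ is the $n\times n$ identity matrix. Let $\Lambda$ be a finite subset of $\mathbb{Z}^3$ and $\beta>0$. A configuration $U$ assigns to each oriented nearest-neighbor edge $(x,y)$ with $x,y\in\Lambda$ an element $U(x,y)\in G$, with $U(y,x)=U(x,y)^{-1}$. For a unit square (plaquette) $p$ with all four vertices in $\Lambda$, let $U_p$ be the ordered product of the $U$'s along its four edges, $U_p=U(x_1,x_2)U(x_2,x_3)U(x_3,x_4)U(x_4,x_1)$, where $x_1,x_2,x_3,x_4$ are the successive vertices of $p$, $x_1$ is the lexicographically smallest and $x_2$ the second-smallest. Let $S_\Lambda(U)=\sum_p \Re\operatorname{Tr}(I-U_p)$ be the Wilson action, the sum running over all such plaquettes. The lattice gauge theory on $\Lambda$ with gauge group $G$, inverse coupling strength $\beta$ and free boundary condition is the probability measure $Z^{-1}e^{-\beta S_\Lambda(U)}\,d\sigma_\Lambda(U)$, where $\sigma_\Lambda$ is the product over edges of the normalized Haar measure of $G$; its expectation is denoted by $\langle\cdot\rangle$.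 For a closed nearest-neighbor loop $\ell=(x_0,\dots,x_k)$ contained in $\Lambda$, let $W_\ell(U)=\operatorname{Tr}(U(x_0,x_1)U(x_1,x_2)\cdots U(x_{k-1},x_k)U(x_k,x_0))$. There is a universal constant $C>0$ (not depending on $n$, $G$, $\Lambda$, $\beta$, $\ell$) such that for all such $n,G,\Lambda,\beta$ and every rectangular loop $\ell$ contained in $\Lambda$ (running once around an axis-parallel rectangle, from any starting vertex and in either direction) with integer side lengths $1\le R\le T$, $$|\langle W_\ell\rangle|\le n\,\exp\Bigl(-\frac{C}{1+n\beta}\,T\log(R+1)\Bigr).$$ In particular the theory confines: for all such $n,G,\beta$ there are a function $V$ with $V(R)\to\infty$ as $R\to\infty$ and a constant $K$ such that $|\langle W_\ell\rangle|\le K e^{-V(R)T}$ for every finite $\Lambda\subset\mathbb{Z}^3$ and every rectangular loop $\ell$ contained in $\Lambda$ with side lengths $R\le T$. -/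

import Mathlib

open MeasureTheory Filter

noncomputable section

namespace LatticeGauge

/-- The integer lattice `ℤ^d`. -/
abbrev Site (d : ℕ) : Type := Fin d → ℤ

/-- The `i`-th standard unit vector of `ℤ^d`. -/
def unitVec {d : ℕ} (i : Fin d) : Site d := Pi.single i 1

/-- The positively oriented nearest-neighbor edges `(x, x + e_i)` with both endpoints in `Λ`. -/
def posEdges {d : ℕ} (Λ : Finset (Site d)) : Finset (Site d × Site d) :=
  (Λ ×ˢ Λ).filter fun e => ∃ i : Fin d, e.2 = e.1 + unitVec i

section GaugeGroup

variable {n : ℕ}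

/-- A subgroup `G ⊆ U(n)` carries its Borel σ-algebra. -/
instance instMeasurableSpaceGroup (G : Subgroup (Matrix.unitaryGroup (Fin n) ℂ)) :
    MeasurableSpace G := borel G

instance instBorelSpaceGroup (G : Subgroup (Matrix.unitaryGroup (Fin n) ℂ)) :
    BorelSpace G := ⟨rfl⟩

instance instSecondCountableTopologyGroup (G : Subgroup (Matrix.unitaryGroup (Fin n) ℂ)) :
    SecondCountableTopology G := by
  have : SecondCountableTopology (Matrix (Fin n) (Fin n) ℂ) :=
    inferInstanceAs (SecondCountableTopology (Fin n → Fin n → ℂ))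
  have : SecondCountableTopology (Matrix.unitaryGroup (Fin n) ℂ) :=
    Topology.IsEmbedding.subtypeVal.secondCountableTopology
  exact Topology.IsEmbedding.subtypeVal.secondCountableTopology

/-- The Haar measure of the compact group `G`, normalized to be a probability measure. -/
def haarProb (G : Subgroup (Matrix.unitaryGroup (Fin n) ℂ)) [CompactSpace G] : Measure G :=
  Measure.haarMeasure (⊤ : TopologicalSpace.PositiveCompacts G)

instance instIsProbabilityMeasureHaarProb (G : Subgroup (Matrix.unitaryGroup (Fin n) ℂ))
    [CompactSpace G] : IsProbabilityMeasure (haarProb G) :=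
  ⟨by simpa [haarProb] using Measure.haarMeasure_self (K₀ := (⊤ : TopologicalSpace.PositiveCompacts G))⟩

variable {d : ℕ}

/-- Lattice gauge configurations on `Λ` with free boundary condition. A configuration is given by
its values on the positively oriented edges; its values on the negatively oriented ones are
determined by `U(y,x) = U(x,y)⁻¹`, see `link`. -/
abbrev Config (G : Subgroup (Matrix.unitaryGroup (Fin n) ℂ)) (Λ : Finset (Site d)) : Type :=
  posEdges Λ → G

variable {G : Subgroup (Matrix.unitaryGroup (Fin n) ℂ)} {Λ : Finset (Site d)}

/-- The group element `U(x,y)` for an oriented nearest-neighbor edge `(x,y)` with `x, y ∈ Λ`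
(and the irrelevant value `1` for all other pairs). -/
def link (U : Config G Λ) (x y : Site d) : G :=
  if h : (x, y) ∈ posEdges Λ then U ⟨(x, y), h⟩
  else if h : (y, x) ∈ posEdges Λ then (U ⟨(y, x), h⟩)⁻¹
  else 1

/-- The constraint `U(y,x) = U(x,y)⁻¹`. -/
theorem link_inv (U : Config G Λ) (x y : Site d) : link U y x = (link U x y)⁻¹ := by
  have key : (x, y) ∈ posEdges Λ → (y, x) ∉ posEdges Λ := by
    simp only [posEdges, Finset.mem_filter, not_and, not_exists]
    rintro ⟨-, i, hi⟩ - j hj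
    have h : unitVec i + unitVec j = (0 : Site d) := by
      have : x + (unitVec i + unitVec j) = x + 0 := by rw [← add_assoc, ← hi, ← hj, add_zero]
      exact add_left_cancel this
    have := congrFun h i
    by_cases hij : i = j <;> simp [unitVec, hij] at this
  unfold link
  by_cases h1 : (x, y) ∈ posEdges Λ
  · simp [h1, key h1]
  · by_cases h2 : (y, x) ∈ posEdges Λ <;> simp [h1, h2]

theorem continuous_link (x y : Site d) : Continuous fun U : Config G Λ => link U x y := by
  unfold link
  split_ifs <;> fun_prop

/-- The trace of an element of `G ⊆ U(n)`, as an `n × n` matrix. -/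
def traceG (g : G) : ℂ :=
  Matrix.trace ((g : Matrix.unitaryGroup (Fin n) ℂ) : Matrix (Fin n) (Fin n) ℂ)

theorem continuous_traceG : Continuous (traceG : G → ℂ) := by
  unfold traceG
  exact (continuous_subtype_val.comp continuous_subtype_val).matrix_trace

/-- The plaquettes of `Λ`: the unit squares with corners `x, x + e_i, x + e_j, x + e_i + e_j`,
`i < j`, all of which belong to `Λ`; such a square is coded by `(x, i, j)`. -/
def plaquettes (Λ : Finset (Site d)) : Finset (Site d × Fin d × Fin d) :=
  (Λ ×ˢ (Finset.univ : Finset (Fin d × Fin d))).filter fun p =>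
    p.2.1 < p.2.2 ∧ p.1 + unitVec p.2.1 ∈ Λ ∧ p.1 + unitVec p.2.2 ∈ Λ ∧
      p.1 + unitVec p.2.1 + unitVec p.2.2 ∈ Λ

/-- The holonomy `U(x₁,x₂) U(x₂,x₃) U(x₃,x₄) U(x₄,x₁)` around the plaquette `(x, i, j)`. As `i < j`,
the lexicographically smallest corner is `x₁ = x`, and the second-smallest is `x₂ = x + e_j`. -/
def holonomy (U : Config G Λ) (p : Site d × Fin d × Fin d) : G :=
  link U p.1 (p.1 + unitVec p.2.2) *
    link U (p.1 + unitVec p.2.2) (p.1 + unitVec p.2.1 + unitVec p.2.2) *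
    link U (p.1 + unitVec p.2.1 + unitVec p.2.2) (p.1 + unitVec p.2.1) *
    link U (p.1 + unitVec p.2.1) p.1

/-- The Wilson action `S_Λ(U) = ∑_p Re Tr(I - U_p)`. -/
def wilsonAction (U : Config G Λ) : ℝ :=
  ∑ p ∈ plaquettes Λ, (traceG (1 : G) - traceG (holonomy U p)).re

theorem continuous_wilsonAction : Continuous (wilsonAction : Config G Λ → ℝ) := by
  unfold wilsonAction holonomy
  refine continuous_finsetSum _ fun p _ => Complex.continuous_re.comp
    (continuous_const.sub (continuous_traceG.comp ?_))
  exact (((continuous_link _ _).mul (continuous_link _ _)).mul (continuous_link _ _)).mul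
    (continuous_link _ _)

/-- The product `σ_Λ` of the normalized Haar measures over the edges of `Λ`. -/
def productHaar (G : Subgroup (Matrix.unitaryGroup (Fin n) ℂ)) [CompactSpace G]
    (Λ : Finset (Site d)) : Measure (Config G Λ) :=
  Measure.pi fun _ => haarProb G

instance instIsProbabilityMeasureProductHaar [CompactSpace G] :
    IsProbabilityMeasure (productHaar G Λ) := by
  unfold productHaar; infer_instance

/-- The Wilsonian lattice gauge theory on `Λ` with free boundary condition: the probability measure
with density `Z⁻¹ exp(-β S_Λ(U))` with respect to `σ_Λ`, where `Z = ∫ exp(-β S_Λ) dσ_Λ`. -/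
def gaugeMeasure (G : Subgroup (Matrix.unitaryGroup (Fin n) ℂ)) [CompactSpace G]
    (Λ : Finset (Site d)) (β : ℝ) : Measure (Config G Λ) :=
  (productHaar G Λ).withDensity fun U =>
    ENNReal.ofReal (Real.exp (-β * wilsonAction U) /
      ∫ V, Real.exp (-β * wilsonAction V) ∂(productHaar G Λ))

instance instIsProbabilityMeasureGaugeMeasure [CompactSpace G] (β : ℝ) :
    IsProbabilityMeasure (gaugeMeasure G Λ β) := by
  have h : Continuous fun U : Config G Λ => Real.exp (-β * wilsonAction U) :=
    Real.continuous_exp.comp (continuous_const.mul continuous_wilsonAction)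
  have : Integrable (fun U : Config G Λ => Real.exp (-β * wilsonAction U)) (productHaar G Λ) :=
    h.integrable_of_hasCompactSupport (HasCompactSupport.of_compactSpace _)
  exact isProbabilityMeasure_tilted this

/-- The Wilson loop observable `Tr(U(x₀,x₁) U(x₁,x₂) ⋯ U(x_{k-1},x_k) U(x_k,x₀))` of the loop
`ℓ = (x₀, …, x_k)`. -/
def wilsonLoop (ℓ : List (Site d)) (U : Config G Λ) : ℂ :=
  traceG (List.zipWith (link U) ℓ (ℓ.rotate 1)).prod

theorem continuous_wilsonLoop (ℓ : List (Site d)) :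
    Continuous (wilsonLoop ℓ : Config G Λ → ℂ) := by
  unfold wilsonLoop
  refine continuous_traceG.comp ?_
  generalize ℓ.rotate 1 = m
  induction ℓ generalizing m with
  | nil => simpa using continuous_const
  | cons a l ih =>
    cases m with
    | nil => simpa using continuous_const
    | cons b m =>
      simp only [List.zipWith_cons_cons, List.prod_cons]
      exact (continuous_link a b).mul (ih m)

theorem integrable_wilsonLoop [CompactSpace G] (β : ℝ) (ℓ : List (Site d)) :
    Integrable (wilsonLoop ℓ) (gaugeMeasure G Λ β) :=
  (continuous_wilsonLoop ℓ).integrable_of_hasCompactSupport (HasCompactSupport.of_compactSpace _)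

/-- The expectation `⟨W_ℓ⟩` of the Wilson loop observable. -/
def wilsonExpectation (G : Subgroup (Matrix.unitaryGroup (Fin n) ℂ)) [CompactSpace G]
    (Λ : Finset (Site d)) (β : ℝ) (ℓ : List (Site d)) : ℂ :=
  ∫ U, wilsonLoop ℓ U ∂(gaugeMeasure G Λ β)

end GaugeGroup

/-- The closed loop that starts at `x` and makes `a` steps `+e_i`, then `b` steps `+e_j`, then `a`
steps `-e_i` and then `b` steps `-e_j`, as the list of its successive vertices. -/
def rectanglePath {d : ℕ} (x : Site d) (i j : Fin d) (a b : ℕ) : List (Site d) :=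
  (List.range a).map (fun m => x + m • unitVec i) ++
    (List.range b).map (fun m => x + a • unitVec i + m • unitVec j) ++
    (List.range a).map (fun m => x + (a - m) • unitVec i + b • unitVec j) ++
    (List.range b).map (fun m => x + (b - m) • unitVec j)

/-- `ℓ` is a rectangular loop with side lengths `R` and `T`: it runs once around a nondegenerate
axis-parallel rectangle with these side lengths, from any starting point and in either direction
(exchanging the axes `i` and `j` reverses the direction). -/
def IsRectangularLoop {d : ℕ} (ℓ : List (Site d)) (R T : ℕ) : Prop :=
  0 < R ∧ 0 < T ∧ ∃ (x : Site d) (i j : Fin d), i ≠ j ∧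
    (ℓ ~r rectanglePath x i j R T ∨ ℓ ~r rectanglePath x i j T R)

/-- The theory on `ℤ^d` with gauge group `G` and inverse coupling strength `β` confines: there are
a potential `V` with `V(R) → ∞` as `R → ∞` and a constant `K` such that `|⟨W_ℓ⟩| ≤ K e^{-V(R) T}`
for all rectangular loops `ℓ` with side lengths `R ≤ T` and all finite `Λ` containing `ℓ`. -/
def Confines {n : ℕ} (d : ℕ) (G : Subgroup (Matrix.unitaryGroup (Fin n) ℂ)) [CompactSpace G]
    (β : ℝ) : Prop :=
  ∃ V : ℝ → ℝ, Tendsto V atTop atTop ∧ ∃ K : ℝ,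
    ∀ (Λ : Finset (Site d)) (R T : ℕ) (ℓ : List (Site d)),
      IsRectangularLoop ℓ R T → R ≤ T → (∀ x ∈ ℓ, x ∈ Λ) →
        ‖wilsonExpectation G Λ β ℓ‖ ≤ K * Real.exp (-(V R * T))

end LatticeGauge

end

/-! This is a complex-rotation argument in the style of McBryan and Spencer. Scalars are central, so
multiplying the links by phases `e^{isα}`, with `α` antisymmetric on oriented edges, multiplies each
ordered product by `e^{is·(circulation of α)}`. The rotation is a translation of the product Haar
measure, so the rotated integral does not depend on real `s`. It is entire in `s`, hence constant,
and may be evaluated at `s = i`. There the loop gains the factor `e^{-A}`, with `A` its circulation,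
while a plaquette of circulation `b` raises the exponent by at most `nβ(cosh b - 1)`. This is
`norm_wilsonExpectation_le`.

It remains to choose `α` (`exists_wall`). It lives on the edges parallel to the side of length `T`,
and its value is `c` times a truncated logarithm of the sup-distance to the line carrying one such
side. That side sees the full height `c·H_R`, with `H_R` the harmonic number; the opposite side, at
distance `R`, sees zero. Hence `|A| = cT·H_R`. In each slice there are `O(k)` plaquettes where `α`
jumps by `c/k`, so the cost is at most a constant times `nβ·c²T·∑ k/k² = nβ·c²T·H_R`. Taking `c` of
order `1/(1+nβ)` lets the linear gain beat the quadratic cost, and `H_R ≥ log(R+1)`. -/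

namespace LatticeGauge

/-! ### Central rotations and the phases they produce -/

section Rotation

variable {n : ℕ} {G : Subgroup (Matrix.unitaryGroup (Fin n) ℂ)}

/-- The underlying matrix of an element of the gauge group. -/
def toMatrix (g : G) : Matrix (Fin n) (Fin n) ℂ := ((g : Matrix.unitaryGroup (Fin n) ℂ) : Matrix _ _ ℂ)

theorem toMatrix_mul (g h : G) : toMatrix (g * h) = toMatrix g * toMatrix h := rfl

theorem toMatrix_inv (g : G) : toMatrix g⁻¹ = star (toMatrix g) := rfl

/-- `g = e^{iθ} h` as matrices. -/
def IsRotation (θ : ℝ) (g h : G) : Prop :=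
  toMatrix g = Complex.exp (θ * Complex.I) • toMatrix h

theorem IsRotation.refl (g : G) : IsRotation 0 g g := by
  simp [IsRotation]

theorem IsRotation.mul {θ φ : ℝ} {g g' h h' : G} (h₁ : IsRotation θ g h)
    (h₂ : IsRotation φ g' h') : IsRotation (θ + φ) (g * g') (h * h') := by
  unfold IsRotation at *
  rw [toMatrix_mul, toMatrix_mul, h₁, h₂, smul_mul_smul_comm, ← Complex.exp_add]
  push_cast
  rw [add_mul]

theorem star_exp_mul_I (θ : ℝ) :
    (starRingEnd ℂ) (Complex.exp (θ * Complex.I)) = Complex.exp (-(θ * Complex.I)) := by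
  rw [← Complex.exp_conj]
  simp

theorem IsRotation.inv {θ : ℝ} {g h : G} (h₁ : IsRotation θ g h) :
    IsRotation (-θ) g⁻¹ h⁻¹ := by
  unfold IsRotation at *
  rw [toMatrix_inv, toMatrix_inv, h₁, star_smul]
  congr 1
  rw [Complex.star_def, star_exp_mul_I]
  push_cast
  rw [neg_mul]

theorem IsRotation.traceG {θ : ℝ} {g h : G} (h₁ : IsRotation θ g h) :
    traceG g = Complex.exp (θ * Complex.I) * traceG h := by
  change Matrix.trace (toMatrix g) = _ * Matrix.trace (toMatrix h)
  rw [h₁, Matrix.trace_smul, smul_eq_mul]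

theorem norm_traceG_le (g : G) : ‖traceG g‖ ≤ n := by
  refine (norm_sum_le Finset.univ fun i => toMatrix g i i).trans ?_
  refine (Finset.sum_le_card_nsmul _ _ 1 fun i _ => ?_).trans (by simp)
  exact entry_norm_bound_of_unitary (g : Matrix.unitaryGroup (Fin n) ℂ).2 i i

theorem traceG_one : traceG (1 : G) = n := by
  change Matrix.trace (1 : Matrix (Fin n) (Fin n) ℂ) = n
  simp

variable {d : ℕ} {Λ : Finset (Site d)}

/-- The antisymmetric function on oriented edges determined by a function `a` on the positively
oriented edges of `Λ`. -/
noncomputable def edgeForm (Λ : Finset (Site d)) (a : Site d → Site d → ℝ) (x y : Site d) : ℝ :=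
  (if (x, y) ∈ posEdges Λ then a x y else 0) - (if (y, x) ∈ posEdges Λ then a y x else 0)

theorem edgeForm_swap (Λ : Finset (Site d)) (a : Site d → Site d → ℝ) (x y : Site d) :
    edgeForm Λ a y x = -edgeForm Λ a x y := by
  simp [edgeForm]

theorem swap_notMem_posEdges {x y : Site d} (h : (x, y) ∈ posEdges Λ) : (y, x) ∉ posEdges Λ := by
  intro h'
  simp only [posEdges, Finset.mem_filter] at h h'
  obtain ⟨-, i, hi⟩ := h
  obtain ⟨-, j, hj⟩ := h'
  have h1 := congrFun hi i
  have h2 := congrFun hj i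
  by_cases hij : i = j <;> simp [unitVec, hij] at h1 h2 <;> omega

/-- The circulation of an edge function around a plaquette. -/
noncomputable def plaquetteForm (α : Site d → Site d → ℝ) (p : Site d × Fin d × Fin d) : ℝ :=
  α p.1 (p.1 + unitVec p.2.2) +
    α (p.1 + unitVec p.2.2) (p.1 + unitVec p.2.1 + unitVec p.2.2) +
    α (p.1 + unitVec p.2.1 + unitVec p.2.2) (p.1 + unitVec p.2.1) +
    α (p.1 + unitVec p.2.1) p.1

/-- The circulation of an edge function around a closed loop. -/
noncomputable def loopForm (α : Site d → Site d → ℝ) (ℓ : List (Site d)) : ℝ :=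
  (List.zipWith α ℓ (ℓ.rotate 1)).sum

/-- This is where the scalars in `G` are used. The rotation is a left translation `g * U`, so Haar
invariance applies to it. Inversion on reversed edges turns the phase into its conjugate, which is
why the angle is the antisymmetric `edgeForm`. -/
theorem exists_central_shift
    (hG : ∀ z : ℂ, ‖z‖ = 1 → ∃ g ∈ G, (g : Matrix (Fin n) (Fin n) ℂ) = z • 1)
    (a : Site d → Site d → ℝ) (s : ℝ) :
    ∃ g : Config G Λ, ∀ (U : Config G Λ) (x y : Site d),
      IsRotation (s * edgeForm Λ a x y) (link (g * U) x y) (link U x y) := by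
  have hG' : ∀ θ : ℝ, ∃ g : G, IsRotation θ g 1 := by
    intro θ
    obtain ⟨g, hg, h⟩ := hG (Complex.exp (θ * Complex.I)) (Complex.norm_exp_ofReal_mul_I θ)
    exact ⟨⟨g, hg⟩, h⟩
  choose c hc using hG'
  refine ⟨fun e => c (s * a e.1.1 e.1.2), fun U x y => ?_⟩
  have key : ∀ x y (h : (x, y) ∈ posEdges Λ),
      IsRotation (s * a x y) (((fun e => c (s * a e.1.1 e.1.2)) * U : Config G Λ) ⟨(x, y), h⟩)
        (U ⟨(x, y), h⟩) := fun x y h => by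
    simpa using (hc (s * a x y)).mul (IsRotation.refl (U ⟨(x, y), h⟩))
  unfold link edgeForm
  by_cases h1 : (x, y) ∈ posEdges Λ
  · simpa [h1, swap_notMem_posEdges h1] using key x y h1
  · by_cases h2 : (y, x) ∈ posEdges Λ
    · simpa [h1, h2] using (key y x h2).inv
    · simpa [h1, h2] using IsRotation.refl (1 : G)

theorem isRotation_zipWith_prod {α : Site d → Site d → ℝ} {u v : Site d → Site d → G} {s : ℝ}
    (h : ∀ x y, IsRotation (s * α x y) (u x y) (v x y)) (l m : List (Site d)) :
    IsRotation (s * (List.zipWith α l m).sum) (List.zipWith u l m).prod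
      (List.zipWith v l m).prod := by
  induction l generalizing m with
  | nil => simpa using IsRotation.refl (1 : G)
  | cons x l ih =>
    cases m with
    | nil => simpa using IsRotation.refl (1 : G)
    | cons y m =>
      simp only [List.zipWith_cons_cons, List.sum_cons, List.prod_cons, mul_add]
      exact (h x y).mul (ih m)

theorem wilsonLoop_of_isRotation {α : Site d → Site d → ℝ} {U V : Config G Λ} {s : ℝ}
    (h : ∀ x y, IsRotation (s * α x y) (link V x y) (link U x y)) (ℓ : List (Site d)) :
    wilsonLoop ℓ V = Complex.exp ((s * loopForm α ℓ : ℝ) * Complex.I) * wilsonLoop ℓ U :=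
  (isRotation_zipWith_prod h ℓ (ℓ.rotate 1)).traceG

theorem traceG_holonomy_of_isRotation {α : Site d → Site d → ℝ} {U V : Config G Λ} {s : ℝ}
    (h : ∀ x y, IsRotation (s * α x y) (link V x y) (link U x y)) (p : Site d × Fin d × Fin d) :
    traceG (holonomy V p) =
      Complex.exp ((s * plaquetteForm α p : ℝ) * Complex.I) * traceG (holonomy U p) := by
  have := (((h p.1 (p.1 + unitVec p.2.2)).mul
    (h (p.1 + unitVec p.2.2) (p.1 + unitVec p.2.1 + unitVec p.2.2))).mul
    (h (p.1 + unitVec p.2.1 + unitVec p.2.2) (p.1 + unitVec p.2.1))).mul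
    (h (p.1 + unitVec p.2.1) p.1)
  rw [← mul_add, ← mul_add, ← mul_add] at this
  exact this.traceG

theorem continuous_holonomy (p : Site d × Fin d × Fin d) :
    Continuous fun U : Config G Λ => holonomy U p :=
  (((continuous_link _ _).mul (continuous_link _ _)).mul (continuous_link _ _)).mul
    (continuous_link _ _)

end Rotation

/-! ### Analytic continuation in the rotation angle -/

section ComplexRotation

variable {n : ℕ} {G : Subgroup (Matrix.unitaryGroup (Fin n) ℂ)} {d : ℕ} {Λ : Finset (Site d)}

/-- The holomorphic extension in `z` of the exponent `i z A - β S_Λ` for the configuration obtained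
from `U` by rotating the link variables by the angles `z α`, where `A` and `b p` are the
circulations of `α` around the loop and the plaquettes. -/
noncomputable def rotatedExponent (β A : ℝ) (b : Site d × Fin d × Fin d → ℝ) (z : ℂ) (U : Config G Λ) : ℂ :=
  z * A * Complex.I - β * ∑ p ∈ plaquettes Λ, (n -
    (Complex.exp (z * b p * Complex.I) * traceG (holonomy U p) +
      Complex.exp (-(z * b p * Complex.I)) * (starRingEnd ℂ) (traceG (holonomy U p))) / 2)

/-- The derivative of `rotatedExponent` in `z`. -/
noncomputable def rotatedExponentDeriv (β A : ℝ) (b : Site d × Fin d × Fin d → ℝ) (z : ℂ) (U : Config G Λ) : ℂ :=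
  A * Complex.I - β * ∑ p ∈ plaquettes Λ,
    -((Complex.exp (z * b p * Complex.I) * (b p * Complex.I) * traceG (holonomy U p) +
      Complex.exp (-(z * b p * Complex.I)) * (-(b p * Complex.I)) *
        (starRingEnd ℂ) (traceG (holonomy U p))) / 2)

theorem hasDerivAt_rotatedExponent (β A : ℝ) (b : Site d × Fin d × Fin d → ℝ) (z : ℂ)
    (U : Config G Λ) :
    HasDerivAt (fun z => rotatedExponent β A b z U) (rotatedExponentDeriv β A b z U) z := by
  have lin : ∀ c : ℝ, HasDerivAt (fun z : ℂ => z * c * Complex.I) (c * Complex.I) z := fun c => by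
    simpa using ((hasDerivAt_id z).mul_const (c : ℂ)).mul_const Complex.I
  refine (lin A).sub ((HasDerivAt.fun_sum fun p _ => ?_).const_mul _)
  refine HasDerivAt.const_sub _ (HasDerivAt.div_const (HasDerivAt.add ?_ ?_) _)
  · exact ((lin (b p)).cexp).mul_const _
  · exact ((lin (b p)).neg.cexp).mul_const _

theorem continuous_traceG_holonomy_snd (p : Site d × Fin d × Fin d) :
    Continuous fun q : ℂ × Config G Λ => traceG (holonomy q.2 p) :=
  continuous_traceG.comp ((continuous_holonomy p).comp continuous_snd)

theorem continuous_rotatedExponent (β A : ℝ) (b : Site d × Fin d × Fin d → ℝ) :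
    Continuous fun q : ℂ × Config G Λ => rotatedExponent β A b q.1 q.2 := by
  unfold rotatedExponent
  have h := fun p => continuous_traceG_holonomy_snd (G := G) (Λ := Λ) p
  have h' := fun p => Complex.continuous_conj.comp (h p)
  simp only [Function.comp_def] at h'
  fun_prop

theorem continuous_rotatedExponentDeriv (β A : ℝ) (b : Site d × Fin d × Fin d → ℝ) :
    Continuous fun q : ℂ × Config G Λ => rotatedExponentDeriv β A b q.1 q.2 := by
  unfold rotatedExponentDeriv
  have h := fun p => continuous_traceG_holonomy_snd (G := G) (Λ := Λ) p
  have h' := fun p => Complex.continuous_conj.comp (h p)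
  simp only [Function.comp_def] at h'
  fun_prop

end ComplexRotation

/-- Differentiation under the integral over a compact space. -/
theorem differentiable_integral_of_continuous {X : Type*} [TopologicalSpace X] [CompactSpace X]
    [SecondCountableTopology X] [MeasurableSpace X] [BorelSpace X] (μ : Measure X)
    [IsFiniteMeasure μ] {F F' : ℂ → X → ℂ} (hF : Continuous fun q : ℂ × X => F q.1 q.2)
    (hF' : Continuous fun q : ℂ × X => F' q.1 q.2)
    (h : ∀ z x, HasDerivAt (fun z => F z x) (F' z x) z) :
    Differentiable ℂ fun z => ∫ x, F z x ∂μ := by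
  intro z₀
  have hc : ∀ z, Continuous (F z) := fun z => hF.comp (by fun_prop : Continuous fun x => (z, x))
  have hc' : ∀ z, Continuous (F' z) := fun z => hF'.comp (by fun_prop : Continuous fun x => (z, x))
  obtain ⟨M, hM⟩ := ((isCompact_closedBall z₀ 1).prod (isCompact_univ (X := X))).exists_bound_of_continuousOn
    hF'.continuousOn
  refine (hasDerivAt_integral_of_dominated_loc_of_deriv_le (F' := F') (bound := fun _ => M)
    (Metric.closedBall_mem_nhds z₀ one_pos) (Eventually.of_forall fun z => (hc z).aestronglyMeasurable)
    ((hc z₀).integrable_of_hasCompactSupport (HasCompactSupport.of_compactSpace _))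
    (hc' z₀).aestronglyMeasurable (Eventually.of_forall fun x z hz => ?_) (integrable_const M)
    (Eventually.of_forall fun x z _ => h z x)).2.differentiableAt
  exact hM (z, x) ⟨hz, Set.mem_univ x⟩

/-- Identity theorem: the nonzero reals accumulate at `0`. -/
theorem eq_of_differentiable_of_eq_on_real {f : ℂ → ℂ} (hf : Differentiable ℂ f) {c : ℂ}
    (h : ∀ s : ℝ, f s = c) (z : ℂ) : f z = c := by
  have h1 : AnalyticOnNhd ℂ f Set.univ := fun z _ => hf.analyticAt z
  have h2 : AnalyticOnNhd ℂ (fun _ : ℂ => c) Set.univ := analyticOnNhd_const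
  have : f = fun _ => c := by
    refine h1.eq_of_frequently_eq (z₀ := 0) h2 ?_
    have ht : Tendsto (fun s : ℝ => (s : ℂ)) (nhdsWithin 0 {0}ᶜ) (nhdsWithin 0 {0}ᶜ) := by
      refine tendsto_nhdsWithin_iff.2 ⟨?_, ?_⟩
      · exact (Complex.continuous_ofReal.tendsto' 0 0 (by simp)).mono_left nhdsWithin_le_nhds
      · filter_upwards [self_mem_nhdsWithin] with s hs
        simpa using hs
    exact ht.frequently (Eventually.of_forall h).frequently
  exact congrFun this z

/-! ### Bounding the expectation at imaginary angle -/

section MainEstimate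

variable {n : ℕ} {G : Subgroup (Matrix.unitaryGroup (Fin n) ℂ)} {d : ℕ} {Λ : Finset (Site d)}

/-- For real angles the two exponentials in `rotatedExponent` are conjugate, so their half-sum is
the real part of the rotated plaquette trace. Writing them separately, instead of taking a real
part, is what keeps the exponent holomorphic. -/
theorem exp_rotatedExponent_ofReal {α : Site d → Site d → ℝ} {U V : Config G Λ} {s : ℝ}
    (h : ∀ x y, IsRotation (s * α x y) (link V x y) (link U x y)) (β : ℝ) (ℓ : List (Site d)) :
    wilsonLoop ℓ U * Complex.exp (rotatedExponent β (loopForm α ℓ) (plaquetteForm α) s U) =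
      wilsonLoop ℓ V * (Real.exp (-β * wilsonAction V) : ℝ) := by
  have key : rotatedExponent β (loopForm α ℓ) (plaquetteForm α) s U =
      (s * loopForm α ℓ : ℝ) * Complex.I + ((-β * wilsonAction V : ℝ) : ℂ) := by
    unfold rotatedExponent wilsonAction
    push_cast
    rw [sub_eq_add_neg, ← neg_mul]
    congr 2
    refine Finset.sum_congr rfl fun p _ => ?_
    rw [traceG_one, Complex.sub_re, Complex.natCast_re, Complex.ofReal_sub, Complex.ofReal_natCast,
      Complex.re_eq_add_conj, traceG_holonomy_of_isRotation h, map_mul, star_exp_mul_I]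
    push_cast
    rfl
  rw [key, Complex.exp_add, wilsonLoop_of_isRotation h, Complex.ofReal_exp]
  ring

/-- At `z = i` the phases become `e^{∓b}`, so a plaquette contributes `cosh b · Re Tr U_p`. This
exceeds `Re Tr U_p` by at most `n(cosh b - 1)`, because `Re Tr U_p ≤ n` and `cosh b ≥ 1`. -/
theorem re_rotatedExponent_I_le {β : ℝ} (hβ : 0 ≤ β) (A : ℝ) (b : Site d × Fin d × Fin d → ℝ)
    (U : Config G Λ) :
    (rotatedExponent β A b Complex.I U).re ≤
      -β * wilsonAction U + (-A + n * β * ∑ p ∈ plaquettes Λ, (Real.cosh (b p) - 1)) := by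
  have hI : ∀ c : ℝ, Complex.I * c * Complex.I = ((-c : ℝ) : ℂ) := fun c => by
    rw [mul_right_comm, Complex.I_mul_I]; push_cast; ring
  have key : rotatedExponent β A b Complex.I U = ((-A : ℝ) : ℂ) - (β : ℂ) * ∑ p ∈ plaquettes Λ,
      (n - (((Real.exp (-b p) : ℝ) : ℂ) * traceG (holonomy U p) + ((Real.exp (b p) : ℝ) : ℂ) *
        (starRingEnd ℂ) (traceG (holonomy U p))) / 2) := by
    unfold rotatedExponent
    simp only [hI]
    push_cast
    simp only [neg_neg]
  rw [key, Complex.sub_re, Complex.ofReal_re, Complex.re_ofReal_mul, Complex.re_sum]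
  have hsum : ∑ p ∈ plaquettes Λ, (n - (((Real.exp (-b p) : ℝ) : ℂ) * traceG (holonomy U p) +
      ((Real.exp (b p) : ℝ) : ℂ) * (starRingEnd ℂ) (traceG (holonomy U p))) / 2 : ℂ).re ≥
      wilsonAction U - n * ∑ p ∈ plaquettes Λ, (Real.cosh (b p) - 1) := by
    unfold wilsonAction
    rw [Finset.mul_sum, ← Finset.sum_sub_distrib]
    refine Finset.sum_le_sum fun p _ => ?_
    have h2 : ∀ w : ℂ, (w / 2).re = w.re / 2 := fun w => by
      rw [show (2 : ℂ) = ((2 : ℝ) : ℂ) by norm_num, Complex.div_ofReal_re]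
    rw [Complex.sub_re, Complex.sub_re, h2, Complex.add_re, Complex.re_ofReal_mul,
      Complex.re_ofReal_mul, Complex.conj_re, traceG_one, Complex.natCast_re]
    have h3 : (traceG (holonomy U p)).re ≤ n :=
      (Complex.re_le_norm _).trans (norm_traceG_le _)
    have h4 := Real.one_le_cosh (b p)
    have h5 := mul_le_mul_of_nonneg_left h3 (sub_nonneg.2 h4)
    have h6 := Real.cosh_eq (b p)
    have h7 : (Real.exp (-b p) * (traceG (holonomy U p)).re +
      Real.exp (b p) * (traceG (holonomy U p)).re) / 2 =
      Real.cosh (b p) * (traceG (holonomy U p)).re := by rw [h6]; ring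
    linarith
  have := mul_le_mul_of_nonneg_left hsum hβ
  linarith

/-- A bound on Wilson loop expectations by rotating the link variables with an imaginary angle. -/
theorem norm_wilsonExpectation_le [CompactSpace G]
    (hG : ∀ z : ℂ, ‖z‖ = 1 → ∃ g ∈ G, (g : Matrix (Fin n) (Fin n) ℂ) = z • 1)
    (a : Site d → Site d → ℝ) {β : ℝ} (hβ : 0 ≤ β) (ℓ : List (Site d)) :
    ‖wilsonExpectation G Λ β ℓ‖ ≤ n * Real.exp (-loopForm (edgeForm Λ a) ℓ +
      n * β * ∑ p ∈ plaquettes Λ, (Real.cosh (plaquetteForm (edgeForm Λ a) p) - 1)) := by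
  set α := edgeForm Λ a with hα
  set E := -loopForm α ℓ + n * β * ∑ p ∈ plaquettes Λ, (Real.cosh (plaquetteForm α p) - 1) with hE
  set μ := productHaar G Λ with hμ
  have : μ.IsMulLeftInvariant := by
    rw [hμ]; unfold productHaar haarProb; infer_instance
  let H : ℂ → Config G Λ → ℂ := rotatedExponent β (loopForm α ℓ) (plaquetteForm α)
  let I : ℂ → ℂ := fun z => ∫ U, wilsonLoop ℓ U * Complex.exp (H z U) ∂μ
  have hcS : Continuous fun U : Config G Λ => Real.exp (-β * wilsonAction U) :=
    Real.continuous_exp.comp (continuous_const.mul continuous_wilsonAction)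
  have hI : Differentiable ℂ I := by
    have hW : Continuous fun q : ℂ × Config G Λ => wilsonLoop ℓ q.2 :=
      (continuous_wilsonLoop ℓ).comp continuous_snd
    have hH := continuous_rotatedExponent (G := G) (Λ := Λ) β (loopForm α ℓ) (plaquetteForm α)
    have hH' := continuous_rotatedExponentDeriv (G := G) (Λ := Λ) β (loopForm α ℓ) (plaquetteForm α)
    exact differentiable_integral_of_continuous μ (hW.mul hH.cexp) (hW.mul (hH.cexp.mul hH'))
      fun z U => (hasDerivAt_rotatedExponent _ _ _ z U).cexp.const_mul _
  have hreal : ∀ s : ℝ, I s = ∫ U, wilsonLoop ℓ U * (Real.exp (-β * wilsonAction U) : ℝ) ∂μ := by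
    intro s
    obtain ⟨g, hg⟩ := exists_central_shift (Λ := Λ) hG a s
    -- The translation is applied to the unrotated integral on the right; its integrand at `g * U`
    -- is the rotated one at `U`.
    rw [← integral_mul_left_eq_self _ g]
    exact integral_congr_ae (Eventually.of_forall fun U => exp_rotatedExponent_ofReal (hg U) β ℓ)
  have hII := eq_of_differentiable_of_eq_on_real hI hreal Complex.I
  set Z := ∫ V, Real.exp (-β * wilsonAction V) ∂μ with hZ
  have hZpos : 0 < Z :=
    integral_exp_pos (hcS.integrable_of_hasCompactSupport (HasCompactSupport.of_compactSpace _))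
  have hexp : wilsonExpectation G Λ β ℓ = (Z : ℂ)⁻¹ * I Complex.I := by
    rw [hII, ← integral_const_mul]
    -- `gaugeMeasure` unfolds to the exponential tilting of `productHaar` by `-β * wilsonAction`.
    refine (integral_tilted _ _).trans (integral_congr_ae (Eventually.of_forall fun U => ?_))
    simp only [Complex.real_smul]
    push_cast
    ring
  have hbound : ‖I Complex.I‖ ≤ n * Real.exp E * Z := by
    rw [hZ, ← integral_const_mul]
    refine norm_integral_le_of_norm_le ((hcS.integrable_of_hasCompactSupport
      (HasCompactSupport.of_compactSpace _)).const_mul _) (Eventually.of_forall fun U => ?_)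
    rw [norm_mul, Complex.norm_exp, mul_assoc, ← Real.exp_add]
    refine mul_le_mul (norm_traceG_le _) (Real.exp_le_exp.2 ?_) (Real.exp_nonneg _) (by positivity)
    rw [add_comm]
    exact re_rotatedExponent_I_le hβ _ _ U
  rw [hexp, norm_mul, norm_inv, Complex.norm_real, Real.norm_of_nonneg hZpos.le,
    inv_mul_le_iff₀ hZpos, mul_comm Z]
  exact hbound

end MainEstimate

/-! ### Circulation around a rectangle as a sum over its sides -/

section LoopSums

variable {d : ℕ}

/-- The sum of an edge function along the path with vertex list `l` followed by the vertex `e`. -/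
noncomputable def walkSum (α : Site d → Site d → ℝ) : List (Site d) → Site d → ℝ
  | [], _ => 0
  | x :: l, e => α x ((l ++ [e]).head (by simp)) + walkSum α l e

/-- The endpoint is a separate argument of `walkSum` so that a closed path can be cut: each piece
ends at the first vertex of the next. -/
theorem walkSum_append (α : Site d → Site d → ℝ) (l m : List (Site d)) (e : Site d) :
    walkSum α (l ++ m) e = walkSum α l ((m ++ [e]).head (by simp)) + walkSum α m e := by
  induction l with
  | nil => simp [walkSum]
  | cons x l ih =>
    have : ∀ (l₁ l₂ : List (Site d)) (h : l₁ ++ l₂ ≠ []) (h₂ : l₂ ≠ [])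
        (h' : l₁ ++ [l₂.head h₂] ≠ []),
        (l₁ ++ l₂).head h = (l₁ ++ [l₂.head h₂]).head h' := by
      intro l₁ l₂ h h₂ h'
      cases l₁ <;> simp
    simp only [List.cons_append, walkSum, ih, add_assoc]
    congr 2
    simp only [List.append_assoc]
    exact this _ _ _ _ _

theorem walkSum_map_range (α : Site d → Site d → ℝ) (φ : ℕ → Site d) (a : ℕ) :
    walkSum α ((List.range a).map φ) (φ a) = ∑ m ∈ Finset.range a, α (φ m) (φ (m + 1)) := by
  induction a with
  | zero => simp [walkSum]
  | succ a ih =>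
    rw [List.range_succ, List.map_append, walkSum_append, Finset.sum_range_succ, ← ih]
    simp [walkSum]

theorem zipWith_sum_eq_walkSum (α : Site d → Site d → ℝ) (l : List (Site d)) (e : Site d) :
    (List.zipWith α l ((l ++ [e]).tail)).sum = walkSum α l e := by
  induction l with
  | nil => simp [walkSum]
  | cons x l ih =>
    cases l with
    | nil => simp [walkSum]
    | cons y l => simpa [walkSum] using ih

theorem loopForm_cons (α : Site d → Site d → ℝ) (x : Site d) (l : List (Site d)) :
    loopForm α (x :: l) = walkSum α (x :: l) x := by
  rw [← zipWith_sum_eq_walkSum]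
  simp [loopForm]

/-- Moving the starting vertex only permutes the summands cyclically. -/
theorem loopForm_eq_of_isRotated (α : Site d → Site d → ℝ) {l m : List (Site d)} (h : l ~r m) :
    loopForm α l = loopForm α m := by
  obtain ⟨k, rfl⟩ := h
  unfold loopForm
  rw [List.rotate_rotate, add_comm, ← List.rotate_rotate, ← List.zipWith_rotate_distrib _ _ _ _
    (by simp)]
  exact ((List.rotate_perm _ _).sum_eq).symm

theorem head_map_range_append (φ : ℕ → Site d) {a : ℕ} (ha : 0 < a) (l : List (Site d))
    (h : (List.range a).map φ ++ l ≠ []) : ((List.range a).map φ ++ l).head h = φ 0 := by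
  obtain ⟨a, rfl⟩ := Nat.exists_eq_succ_of_ne_zero ha.ne'
  simp [List.range_succ_eq_map]

theorem loopForm_rectanglePath (α : Site d → Site d → ℝ) (x : Site d) (i j : Fin d) {a b : ℕ}
    (ha : 0 < a) (hb : 0 < b) :
    loopForm α (rectanglePath x i j a b) =
      ∑ m ∈ Finset.range a, α (x + m • unitVec i) (x + (m + 1) • unitVec i) +
      ∑ m ∈ Finset.range b,
        α (x + a • unitVec i + m • unitVec j) (x + a • unitVec i + (m + 1) • unitVec j) +
      ∑ m ∈ Finset.range a, α (x + (a - m) • unitVec i + b • unitVec j)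
        (x + (a - (m + 1)) • unitVec i + b • unitVec j) +
      ∑ m ∈ Finset.range b, α (x + (b - m) • unitVec j) (x + (b - (m + 1)) • unitVec j) := by
  have h0 : loopForm α (rectanglePath x i j a b) = walkSum α (rectanglePath x i j a b) x := by
    obtain ⟨a, rfl⟩ := Nat.exists_eq_succ_of_ne_zero ha.ne'
    have : ∃ l, rectanglePath x i j (a + 1) b = x :: l := by
      simp [rectanglePath, List.range_succ_eq_map]
    obtain ⟨l, hl⟩ := this
    rw [Nat.succ_eq_add_one, hl, loopForm_cons]
  -- Positive side lengths make each side's vertex list nonempty, so its head is the corner where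
  -- the preceding side ends.
  rw [h0, rectanglePath, walkSum_append, walkSum_append, walkSum_append,
    head_map_range_append _ hb, head_map_range_append _ ha, head_map_range_append _ hb]
  refine congrArg₂ _ (congrArg₂ _ (congrArg₂ _ ?_ ?_) ?_) ?_
  · rw [← walkSum_map_range α (fun m => x + m • unitVec i)]
    simp
  · rw [← walkSum_map_range α (fun m => x + a • unitVec i + m • unitVec j)]
    simp
  · rw [← walkSum_map_range α (fun m => x + (a - m) • unitVec i + b • unitVec j)]
    simp
  · rw [← walkSum_map_range α (fun m => x + (b - m) • unitVec j)]
    simp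

theorem mem_rectanglePath {x : Site d} {i j : Fin d} {a b : ℕ} {y : Site d} :
    y ∈ rectanglePath x i j a b ↔ (∃ m < a, x + m • unitVec i = y) ∨
      (∃ m < b, x + a • unitVec i + m • unitVec j = y) ∨
      (∃ m < a, x + (a - m) • unitVec i + b • unitVec j = y) ∨
      (∃ m < b, x + (b - m) • unitVec j = y) := by
  simp [rectanglePath]

end LoopSums

/-! ### The logarithmic wall and its plaquette energy -/

section Wall

/-- The truncated logarithmic potential `∑_{m < k ≤ R} 1/k`. -/
noncomputable def truncLog (R m : ℕ) : ℝ := ∑ k ∈ Finset.Ioc m R, (k : ℝ)⁻¹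

theorem truncLog_of_le {R m : ℕ} (h : R ≤ m) : truncLog R m = 0 := by
  simp [truncLog, Finset.Ioc_eq_empty_of_le h]

theorem truncLog_succ {R m : ℕ} (h : m < R) :
    truncLog R m = truncLog R (m + 1) + ((m + 1 : ℕ) : ℝ)⁻¹ := by
  unfold truncLog
  rw [← Finset.insert_Ioc_add_one_left_eq_Ioc h, Finset.sum_insert (by simp), add_comm]

theorem truncLog_zero (R : ℕ) : truncLog R 0 = harmonic R := by
  rw [harmonic_eq_sum_Icc, truncLog, ← Finset.Icc_add_one_left_eq_Ioc]
  simp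

/-- `|u|` and `|u+1|` are consecutive integers `m` and `m+1` in some order. If `|v| ≥ m+1`, the
sup-distance does not change; otherwise the potential jumps by `1/(m+1)`, or by zero once `m ≥ R`.
Admitting `|v| = m+1` in the bound is harmless slack. -/
theorem sq_truncLog_max_sub_le (R : ℕ) (u v : ℤ) :
    (truncLog R (max u.natAbs v.natAbs) - truncLog R (max (u + 1).natAbs v.natAbs)) ^ 2 ≤
      if v.natAbs ≤ max u.natAbs (u + 1).natAbs ∧ max u.natAbs (u + 1).natAbs ≤ R then
        ((max u.natAbs (u + 1).natAbs : ℕ) : ℝ)⁻¹ ^ 2 else 0 := by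
  have hnn : (0 : ℝ) ≤ if v.natAbs ≤ max u.natAbs (u + 1).natAbs ∧
      max u.natAbs (u + 1).natAbs ≤ R then
        ((max u.natAbs (u + 1).natAbs : ℕ) : ℝ)⁻¹ ^ 2 else 0 := by
    split_ifs <;> positivity
  obtain ⟨m, hm⟩ : ∃ m, max u.natAbs (u + 1).natAbs = m + 1 :=
    Nat.exists_eq_succ_of_ne_zero (by omega)
  rw [hm] at hnn ⊢
  by_cases hv : m + 1 ≤ v.natAbs
  · rw [show max u.natAbs v.natAbs = max (u + 1).natAbs v.natAbs by omega]
    simpa using hnn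
  have hsq : (truncLog R (max u.natAbs v.natAbs) - truncLog R (max (u + 1).natAbs v.natAbs)) ^ 2 =
      (truncLog R m - truncLog R (m + 1)) ^ 2 := by
    rcases le_or_gt 0 u with hu | hu
    · rw [show max u.natAbs v.natAbs = m by omega, show max (u + 1).natAbs v.natAbs = m + 1 by omega]
    · rw [show max u.natAbs v.natAbs = m + 1 by omega, show max (u + 1).natAbs v.natAbs = m by omega]
      ring
  rw [hsq]
  by_cases hR : m + 1 ≤ R
  · rw [if_pos ⟨by omega, hR⟩, truncLog_succ hR, add_sub_cancel_left]
  · rw [truncLog_of_le (by omega : R ≤ m), truncLog_of_le (by omega : R ≤ m + 1)]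
    simpa using hnn

/-- The value, on the edge at `y` in direction `t`, of the logarithmic wall over the segment of
length `T` that starts at `x`. It depends on the distance of `y` from the line through `x` in
direction `t`, measured in the two other directions `s` and `r`. -/
noncomputable def wallValue (t s r : Fin 3) (x : Site 3) (c : ℝ) (R T : ℕ) (y : Site 3) : ℝ :=
  if x t ≤ y t ∧ y t < x t + T then
    c * truncLog R (max (y s - x s).natAbs (y r - x r).natAbs) else 0

/-- The edge function of the logarithmic wall. -/
noncomputable def wallForm (t s r : Fin 3) (x : Site 3) (c : ℝ) (R T : ℕ) (y y' : Site 3) : ℝ :=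
  if y' = y + unitVec t then wallValue t s r x c R T y else 0

variable {t s r : Fin 3} {x : Site 3} {c : ℝ} {R T : ℕ} {Λ : Finset (Site 3)}

theorem unitVec_injective {d : ℕ} : Function.Injective (unitVec (d := d)) := by
  intro i j h
  by_contra hij
  have := congrFun h i
  simp [unitVec, hij] at this

theorem unitVec_add_unitVec_ne_zero {d : ℕ} (i j : Fin d) : unitVec i + unitVec j ≠ 0 := by
  intro h
  have := congrFun h i
  by_cases hij : i = j <;> simp [unitVec, hij] at this

theorem wallForm_step (y : Site 3) (i : Fin 3) :
    wallForm t s r x c R T y (y + unitVec i) = if i = t then wallValue t s r x c R T y else 0 := by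
  simp [wallForm, unitVec_injective.eq_iff]

/-- Membership in `Λ` matters only on edges where the wall is nonzero; elsewhere truncation to `Λ`
changes nothing. -/
theorem edgeForm_step {y : Site 3} {i : Fin 3}
    (h : i = t → wallValue t s r x c R T y ≠ 0 → y ∈ Λ ∧ y + unitVec i ∈ Λ) :
    edgeForm Λ (wallForm t s r x c R T) y (y + unitVec i) =
      if i = t then wallValue t s r x c R T y else 0 := by
  have h2 : wallForm t s r x c R T (y + unitVec i) y = 0 := by
    rw [wallForm, if_neg]
    intro h
    exact unitVec_add_unitVec_ne_zero i t (by simpa [add_assoc] using h)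
  rw [edgeForm, h2, ite_self, sub_zero, wallForm_step]
  by_cases hi : i = t ∧ wallValue t s r x c R T y ≠ 0
  · have h' : (y, y + unitVec i) ∈ posEdges Λ := by
      simp only [posEdges, Finset.mem_filter, Finset.mem_product]
      exact ⟨h hi.1 hi.2, i, rfl⟩
    rw [if_pos h']
  · split_ifs <;> simp_all

/-- Only the two opposite `t`-edges of a plaquette carry the wall, with opposite signs. They share
their `t`-coordinate, so cutting the wall off sharply at its two ends in direction `t` costs no
energy. -/
theorem plaquetteForm_wall {p : Site 3 × Fin 3 × Fin 3} (hp : p ∈ plaquettes Λ) :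
    plaquetteForm (edgeForm Λ (wallForm t s r x c R T)) p =
      (if p.2.2 = t then
        wallValue t s r x c R T p.1 - wallValue t s r x c R T (p.1 + unitVec p.2.1) else 0) -
      (if p.2.1 = t then
        wallValue t s r x c R T p.1 - wallValue t s r x c R T (p.1 + unitVec p.2.2) else 0) := by
  obtain ⟨y, i, j⟩ := p
  simp only [plaquettes, Finset.mem_filter, Finset.mem_product] at hp
  obtain ⟨⟨hy, -⟩, -, hi, hj, hij⟩ := hp
  have hij' : y + unitVec j + unitVec i ∈ Λ := by rwa [add_right_comm]
  simp only [plaquetteForm]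
  have h3 := edgeForm_step (t := t) (s := s) (r := r) (x := x) (c := c) (R := R) (T := T)
    fun _ _ => ⟨hi, hij⟩
  rw [edgeForm_swap Λ _ y (y + unitVec i), edgeForm_swap Λ _ (y + unitVec i), h3,
    add_right_comm y (unitVec i), edgeForm_step fun _ _ => ⟨hy, hj⟩,
    edgeForm_step fun _ _ => ⟨hj, hij'⟩, edgeForm_step fun _ _ => ⟨hy, hi⟩]
  split_ifs <;> ring

/-- Combines `cosh b ≤ e^{b²/2}` with `e^x - 1 ≤ 2x` for `0 ≤ x ≤ 1`. -/
theorem cosh_sub_one_le_sq {b : ℝ} (hb : b ^ 2 ≤ 1) : Real.cosh b - 1 ≤ b ^ 2 := by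
  have h1 := Real.cosh_le_exp_half_sq b
  have h0 := sq_nonneg b
  have h2 := Real.abs_exp_sub_one_le (x := b ^ 2 / 2) (by rw [abs_of_nonneg (by positivity)]; linarith)
  rw [abs_of_nonneg (by positivity : 0 ≤ b ^ 2 / 2)] at h2
  have := le_abs_self (Real.exp (b ^ 2 / 2) - 1)
  linarith

theorem cosh_wallValue_sub_le (hts : t ≠ s) (hsr : s ≠ r) (hc : c ^ 2 ≤ 1) (y : Site 3) :
    Real.cosh (wallValue t s r x c R T y - wallValue t s r x c R T (y + unitVec s)) - 1 ≤
      if (x t ≤ y t ∧ y t < x t + T) ∧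
        (y r - x r).natAbs ≤ max (y s - x s).natAbs (y s - x s + 1).natAbs ∧
        max (y s - x s).natAbs (y s - x s + 1).natAbs ≤ R then
        c ^ 2 * ((max (y s - x s).natAbs (y s - x s + 1).natAbs : ℕ) : ℝ)⁻¹ ^ 2 else 0 := by
  have e1 : (y + unitVec s) t = y t := by simp [unitVec, hts]
  have e2 : (y + unitVec s) r = y r := by simp [unitVec, hsr.symm]
  have e3 : (y + unitVec s) s - x s = y s - x s + 1 := by simp [unitVec]; ring
  unfold wallValue
  rw [e1, e2, e3]
  by_cases ht : x t ≤ y t ∧ y t < x t + T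
  · simp only [ht, and_self, if_true, true_and, ← mul_sub]
    have key := sq_truncLog_max_sub_le R (y s - x s) (y r - x r)
    set D := truncLog R (max (y s - x s).natAbs (y r - x r).natAbs) -
      truncLog R (max (y s - x s + 1).natAbs (y r - x r).natAbs)
    set M := max (y s - x s).natAbs (y s - x s + 1).natAbs with hM
    have hM1 : ((M : ℝ)⁻¹) ^ 2 ≤ 1 := by
      have : (1 : ℝ) ≤ M := by exact_mod_cast (by omega : 1 ≤ M)
      exact pow_le_one₀ (by positivity) (inv_le_one_of_one_le₀ this)
    have hD : D ^ 2 ≤ 1 := key.trans (by split_ifs <;> simp_all)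
    refine (cosh_sub_one_le_sq ?_).trans ?_
    · rw [mul_pow]
      exact mul_le_one₀ hc (sq_nonneg D) hD
    · rw [mul_pow]
      refine (mul_le_mul_of_nonneg_left key (sq_nonneg c)).trans ?_
      split_ifs <;> simp
  · simp [ht]

theorem eq_or_eq_or_eq (hts : t ≠ s) (htr : t ≠ r) (hsr : s ≠ r) (i : Fin 3) :
    i = t ∨ i = s ∨ i = r := by
  omega

/-- In each of the `T` slices, a jump of at most `c/(m+1)` occurs at no more than `2(2m+3)` sites.
Since `2(2m+3)/(m+1)² ≤ 6/(m+1)`, the sum over `m < R` is harmonic. -/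
theorem sum_cosh_wallValue_sub_le (hts : t ≠ s) (htr : t ≠ r) (hsr : s ≠ r) (hc : c ^ 2 ≤ 1) :
    ∑ y ∈ Λ, (Real.cosh (wallValue t s r x c R T y - wallValue t s r x c R T (y + unitVec s)) - 1) ≤
      6 * c ^ 2 * T * harmonic R := by
  classical
  -- `S` codes the possible jump sites by the slice, the level `m`, the sign of the `s`-offset and
  -- the `r`-offset in `[-(m+1), m+1]`. The `s`-offsets `m` and `-m-1` are exactly those with `max
  -- |u| |u+1| = m+1`.
  let S : Finset (Σ _ : ℕ × ℕ × Bool, ℤ) :=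
    (Finset.range T ×ˢ Finset.range R ×ˢ (Finset.univ : Finset Bool)).sigma
      fun q => Finset.Icc (-((q.2.1 : ℤ) + 1)) (q.2.1 + 1)
  let φ : (Σ _ : ℕ × ℕ × Bool, ℤ) → Site 3 := fun q i =>
    if i = t then x t + q.1.1 else if i = s then
      x s + (if q.1.2.2 then (q.1.2.1 : ℤ) else -(q.1.2.1 : ℤ) - 1) else x r + q.2
  let ψ : Site 3 → ℝ := fun y =>
    c ^ 2 * ((max (y s - x s).natAbs (y s - x s + 1).natAbs : ℕ) : ℝ)⁻¹ ^ 2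
  have hψ : ∀ y, 0 ≤ ψ y := fun y => by positivity
  have h1 : ∀ y, Real.cosh (wallValue t s r x c R T y -
      wallValue t s r x c R T (y + unitVec s)) - 1 ≤ if y ∈ S.image φ then ψ y else 0 := by
    intro y
    refine (cosh_wallValue_sub_le hts hsr hc y).trans ?_
    split_ifs with h h' h'
    · exact le_rfl
    · refine absurd ?_ h'
      obtain ⟨⟨ht1, ht2⟩, hv, hR⟩ := h
      rw [Finset.mem_image]
      refine ⟨⟨((y t - x t).toNat, max (y s - x s).natAbs (y s - x s + 1).natAbs - 1,
        decide (0 ≤ y s - x s)), y r - x r⟩, ?_, ?_⟩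
      · simp only [S, Finset.mem_sigma, Finset.mem_product, Finset.mem_range, Finset.mem_univ,
          Finset.mem_Icc, and_true]
        omega
      · funext i
        rcases eq_or_eq_or_eq hts htr hsr i with rfl | rfl | rfl
        · simp only [φ, if_true]
          omega
        · simp only [φ, hts.symm, if_true, if_false, decide_eq_true_eq]
          split_ifs <;> omega
        · simp only [φ, htr.symm, hsr.symm, if_false]
          omega
    · exact hψ y
    · exact le_rfl
  have h2 : ∀ q ∈ S, ψ (φ q) = c ^ 2 * (((q.1.2.1 + 1 : ℕ) : ℝ)⁻¹) ^ 2 := by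
    intro q _
    have : max (φ q s - x s).natAbs (φ q s - x s + 1).natAbs = q.1.2.1 + 1 := by
      simp only [φ, hts.symm, if_true, if_false]
      split_ifs <;> omega
    simp only [ψ, this]
  calc _ ≤ ∑ y ∈ Λ, if y ∈ S.image φ then ψ y else 0 := Finset.sum_le_sum fun y _ => h1 y
    _ ≤ ∑ y ∈ S.image φ, ψ y := by
      rw [← Finset.sum_filter]
      exact Finset.sum_le_sum_of_subset_of_nonneg
        (fun y hy => (Finset.mem_filter.1 hy).2) fun y _ _ => hψ y
    _ ≤ ∑ q ∈ S, ψ (φ q) := Finset.sum_image_le_of_nonneg fun y _ => hψ y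
    _ = ∑ q ∈ S, c ^ 2 * (((q.1.2.1 + 1 : ℕ) : ℝ)⁻¹) ^ 2 := Finset.sum_congr rfl h2
    _ = T * ∑ m ∈ Finset.range R, 2 * ((2 * m + 3 : ℝ) * (c ^ 2 * (((m + 1 : ℕ) : ℝ)⁻¹) ^ 2)) := by
      rw [Finset.sum_sigma, Finset.sum_product]
      simp only [Finset.sum_product, Finset.sum_const, Int.card_Icc, Finset.card_range,
        nsmul_eq_mul, Finset.card_univ, Fintype.card_bool]
      congr 1
      refine Finset.sum_congr rfl fun m _ => ?_
      have : ((((m : ℤ) + 1 + 1 - -((m : ℤ) + 1)).toNat : ℕ) : ℝ) = 2 * m + 3 := by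
        rw [show ((m : ℤ) + 1 + 1 - -((m : ℤ) + 1)).toNat = 2 * m + 3 by omega]
        push_cast; ring
      rw [this]
      push_cast; ring
    _ ≤ T * ∑ m ∈ Finset.range R, 6 * c ^ 2 * ((m + 1 : ℕ) : ℝ)⁻¹ := by
      refine mul_le_mul_of_nonneg_left (Finset.sum_le_sum fun m _ => ?_) (Nat.cast_nonneg T)
      have h3 : (2 * m + 3 : ℝ) * ((m + 1 : ℕ) : ℝ)⁻¹ ≤ 3 := by
        rw [← div_eq_mul_inv, div_le_iff₀ (by positivity)]
        push_cast
        have : (0 : ℝ) ≤ m := Nat.cast_nonneg m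
        linarith
      have h4 : (0 : ℝ) ≤ 2 * c ^ 2 * ((m + 1 : ℕ) : ℝ)⁻¹ := by positivity
      have := mul_le_mul_of_nonneg_left h3 h4
      linarith
    _ = 6 * c ^ 2 * T * harmonic R := by
      rw [← Finset.mul_sum, harmonic]
      push_cast
      ring

theorem wallValue_comm : wallValue t s r x c R T = wallValue t r s x c R T := by
  funext y
  simp only [wallValue, max_comm]

/-- Plaquettes without a `t`-edge have zero circulation; the others span `t` with `s` or `t` with
`r`. The two families obey the same bound because the wall is symmetric in `s` and `r`. -/
theorem sum_cosh_plaquetteForm_wall_le (hts : t ≠ s) (htr : t ≠ r) (hsr : s ≠ r)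
    (hc : c ^ 2 ≤ 1) :
    ∑ p ∈ plaquettes Λ,
      (Real.cosh (plaquetteForm (edgeForm Λ (wallForm t s r x c R T)) p) - 1) ≤
      12 * c ^ 2 * T * harmonic R := by
  let Φ : Fin 3 → Site 3 → ℝ := fun k y =>
    Real.cosh (wallValue t s r x c R T y - wallValue t s r x c R T (y + unitVec k)) - 1
  have hΦ : ∀ k y, 0 ≤ Φ k y := fun k y => sub_nonneg.2 (Real.one_le_cosh _)
  let g : Site 3 × Fin 3 × Fin 3 → ℝ := fun p =>
    if p.2.1 < p.2.2 then (if p.2.2 = t then Φ p.2.1 p.1 else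
      if p.2.1 = t then Φ p.2.2 p.1 else 0) else 0
  have hg : ∀ p, 0 ≤ g p := fun p => by
    simp only [g]
    split_ifs <;> simp [hΦ]
  calc _ ≤ ∑ p ∈ plaquettes Λ, g p := by
        refine Finset.sum_le_sum fun p hp => ?_
        rw [plaquetteForm_wall hp]
        simp only [plaquettes, Finset.mem_filter] at hp
        have hlt := hp.2.1
        simp only [g, hlt, if_true, Φ]
        by_cases h1 : p.2.2 = t
        · have h2 : p.2.1 ≠ t := fun h => by omega
          simp [h1, h2]
        · by_cases h2 : p.2.1 = t
          · simp [h1, h2, abs_sub_comm]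
          · simp [h1, h2]
    _ ≤ ∑ p ∈ Λ ×ˢ (Finset.univ : Finset (Fin 3 × Fin 3)), g p :=
        Finset.sum_le_sum_of_subset_of_nonneg (Finset.filter_subset _ _) fun p _ _ => hg p
    _ = ∑ y ∈ Λ, Φ s y + ∑ y ∈ Λ, Φ r y := by
        rw [Finset.sum_product, ← Finset.sum_add_distrib]
        refine Finset.sum_congr rfl fun y _ => ?_
        simp only [g, Fintype.sum_prod_type, Fin.sum_univ_three]
        fin_cases t <;> fin_cases s <;> fin_cases r <;> simp at hts htr hsr ⊢ <;> ring
    _ ≤ 6 * c ^ 2 * T * harmonic R + 6 * c ^ 2 * T * harmonic R := by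
        refine add_le_add (sum_cosh_wallValue_sub_le hts htr hsr hc) ?_
        have := sum_cosh_wallValue_sub_le (Λ := Λ) (x := x) (T := T) (R := R) htr hts hsr.symm hc
        rwa [wallValue_comm] at this
    _ = _ := by ring

end Wall

/-! ### Circulation of the wall around a rectangle -/

section WallLoop

variable {t s r : Fin 3} {x : Site 3} {c : ℝ} {R T : ℕ} {Λ : Finset (Site 3)}

theorem edgeForm_eq_zero {y : Site 3} {i : Fin 3} (h : i = t → wallValue t s r x c R T y = 0) :
    edgeForm Λ (wallForm t s r x c R T) y (y + unitVec i) = 0 := by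
  rw [edgeForm_step fun hi hy => absurd (h hi) hy]
  split_ifs with hi
  · exact h hi
  · rfl

theorem wallValue_near (hts : t ≠ s) (htr : t ≠ r) {m : ℕ} (hm : m < T) :
    wallValue t s r x c R T (x + m • unitVec t) = c * harmonic R := by
  simp [wallValue, unitVec, hts.symm, htr.symm, hm, truncLog_zero]

theorem wallValue_far (hts : t ≠ s) (m : ℕ) :
    wallValue t s r x c R T (x + R • unitVec s + m • unitVec t) = 0 := by
  unfold wallValue
  rw [truncLog_of_le, mul_zero, ite_self]
  simp [unitVec, hts.symm]

/-- Only the side on the wall's axis contributes, at full height on each of its `T` edges. The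
parallel side lies at distance `R`, where the potential vanishes, and the other two are
perpendicular to `t`. -/
theorem loopForm_rectanglePath_long_first (hts : t ≠ s) (htr : t ≠ r) (hR : 0 < R) (hT : 0 < T)
    (hΛ : ∀ y ∈ rectanglePath x t s T R, y ∈ Λ) :
    loopForm (edgeForm Λ (wallForm t s r x c R T)) (rectanglePath x t s T R) =
      T * (c * harmonic R) := by
  have hx : ∀ m ≤ T, x + m • unitVec t ∈ Λ := fun m hm => by
    refine hΛ _ (mem_rectanglePath.2 ?_)
    rcases hm.lt_or_eq with h | rfl
    · exact Or.inl ⟨m, h, rfl⟩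
    · exact Or.inr (Or.inl ⟨0, hR, by simp⟩)
  rw [loopForm_rectanglePath _ _ _ _ hT hR]
  have h1 : ∀ m ∈ Finset.range T, edgeForm Λ (wallForm t s r x c R T) (x + m • unitVec t)
      (x + (m + 1) • unitVec t) = c * harmonic R := fun m hm => by
    have hm := Finset.mem_range.1 hm
    have hx1 := hx (m + 1) hm
    rw [succ_nsmul, ← add_assoc] at hx1 ⊢
    rw [edgeForm_step fun _ _ => ⟨hx m hm.le, hx1⟩, if_pos rfl, wallValue_near hts htr hm]
  have h2 : ∀ m ∈ Finset.range R, edgeForm Λ (wallForm t s r x c R T)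
      (x + T • unitVec t + m • unitVec s) (x + T • unitVec t + (m + 1) • unitVec s) = 0 :=
    fun m _ => by
      rw [succ_nsmul, ← add_assoc]
      exact edgeForm_eq_zero fun h => absurd h hts.symm
  have h3 : ∀ m ∈ Finset.range T, edgeForm Λ (wallForm t s r x c R T)
      (x + (T - m) • unitVec t + R • unitVec s) (x + (T - (m + 1)) • unitVec t + R • unitVec s) =
      0 := fun m hm => by
    have hm := Finset.mem_range.1 hm
    rw [show T - m = T - (m + 1) + 1 by omega, add_right_comm, add_right_comm _ _ (R • unitVec s),
      succ_nsmul, ← add_assoc, edgeForm_swap,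
      edgeForm_eq_zero fun _ => wallValue_far hts _, neg_zero]
  have h4 : ∀ m ∈ Finset.range R, edgeForm Λ (wallForm t s r x c R T)
      (x + (R - m) • unitVec s) (x + (R - (m + 1)) • unitVec s) = 0 := fun m hm => by
    have hm := Finset.mem_range.1 hm
    rw [show R - m = R - (m + 1) + 1 by omega, succ_nsmul, ← add_assoc, edgeForm_swap,
      edgeForm_eq_zero fun h => absurd h hts.symm, neg_zero]
  rw [Finset.sum_congr rfl h1, Finset.sum_congr rfl h2, Finset.sum_congr rfl h3,
    Finset.sum_congr rfl h4]
  simp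

/-- The side on the axis is now the last one and is traversed against `t`, hence the sign. -/
theorem loopForm_rectanglePath_long_second (hts : t ≠ s) (htr : t ≠ r) (hR : 0 < R) (hT : 0 < T)
    (hΛ : ∀ y ∈ rectanglePath x s t R T, y ∈ Λ) :
    loopForm (edgeForm Λ (wallForm t s r x c R T)) (rectanglePath x s t R T) =
      -(T * (c * harmonic R)) := by
  have hx : ∀ m ≤ T, x + m • unitVec t ∈ Λ := fun m hm => by
    refine hΛ _ (mem_rectanglePath.2 ?_)
    rcases Nat.eq_zero_or_pos m with rfl | h
    · exact Or.inl ⟨0, hR, by simp⟩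
    · exact Or.inr (Or.inr (Or.inr ⟨T - m, by omega, by rw [Nat.sub_sub_self hm]⟩))
  rw [loopForm_rectanglePath _ _ _ _ hR hT]
  have h1 : ∀ m ∈ Finset.range R, edgeForm Λ (wallForm t s r x c R T) (x + m • unitVec s)
      (x + (m + 1) • unitVec s) = 0 := fun m _ => by
    rw [succ_nsmul, ← add_assoc]
    exact edgeForm_eq_zero fun h => absurd h hts.symm
  have h2 : ∀ m ∈ Finset.range T, edgeForm Λ (wallForm t s r x c R T)
      (x + R • unitVec s + m • unitVec t) (x + R • unitVec s + (m + 1) • unitVec t) = 0 :=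
    fun m _ => by
      rw [succ_nsmul, ← add_assoc]
      exact edgeForm_eq_zero fun _ => wallValue_far hts _
  have h3 : ∀ m ∈ Finset.range R, edgeForm Λ (wallForm t s r x c R T)
      (x + (R - m) • unitVec s + T • unitVec t) (x + (R - (m + 1)) • unitVec s + T • unitVec t) =
      0 := fun m hm => by
    have hm := Finset.mem_range.1 hm
    rw [show R - m = R - (m + 1) + 1 by omega, add_right_comm, add_right_comm _ _ (T • unitVec t),
      succ_nsmul, ← add_assoc, edgeForm_swap, edgeForm_eq_zero fun h => absurd h hts.symm, neg_zero]
  have h4 : ∀ m ∈ Finset.range T, edgeForm Λ (wallForm t s r x c R T)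
      (x + (T - m) • unitVec t) (x + (T - (m + 1)) • unitVec t) = -(c * harmonic R) :=
    fun m hm => by
      have hm := Finset.mem_range.1 hm
      have hx1 := hx (T - (m + 1) + 1) (by omega)
      rw [show T - m = T - (m + 1) + 1 by omega]
      rw [succ_nsmul, ← add_assoc] at hx1 ⊢
      rw [edgeForm_swap, edgeForm_step fun _ _ => ⟨hx _ (by omega), hx1⟩, if_pos rfl,
        wallValue_near hts htr (by omega)]
  rw [Finset.sum_congr rfl h1, Finset.sum_congr rfl h2, Finset.sum_congr rfl h3,
    Finset.sum_congr rfl h4]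
  simp

end WallLoop

/-! ### Choice of the wall and of its height -/

theorem exists_third (i j : Fin 3) : ∃ k, i ≠ k ∧ j ≠ k := by
  revert i j
  decide

/-- A logarithmic wall whose circulation around a rectangular loop is large. -/
theorem exists_wall {R T : ℕ} {ℓ : List (Site 3)} (hℓ : IsRectangularLoop ℓ R T)
    {Λ : Finset (Site 3)} (hΛ : ∀ x ∈ ℓ, x ∈ Λ) {δ : ℝ} (hδ : δ ^ 2 ≤ 1) :
    ∃ a : Site 3 → Site 3 → ℝ, loopForm (edgeForm Λ a) ℓ = T * (δ * harmonic R) ∧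
      ∑ p ∈ plaquettes Λ, (Real.cosh (plaquetteForm (edgeForm Λ a) p) - 1) ≤
        12 * δ ^ 2 * T * harmonic R := by
  obtain ⟨hR, hT, x, i, j, hij, h | h⟩ := hℓ
  · obtain ⟨r, hir, hjr⟩ := exists_third i j
    -- Here the axis side is traversed backwards; the height `-δ` restores a positive circulation.
    refine ⟨wallForm j i r x (-δ) R T, ?_, ?_⟩
    · rw [loopForm_eq_of_isRotated _ h, loopForm_rectanglePath_long_second hij.symm hjr hR hT
        fun y hy => hΛ y (h.mem_iff.2 hy)]
      ring
    · have := sum_cosh_plaquetteForm_wall_le (x := x) (R := R) (T := T) (Λ := Λ) (c := -δ)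
        hij.symm hjr hir (by rwa [neg_sq])
      rwa [neg_sq] at this
  · obtain ⟨r, hir, hjr⟩ := exists_third i j
    refine ⟨wallForm i j r x δ R T, ?_, sum_cosh_plaquetteForm_wall_le hij hir hjr hδ⟩
    rw [loopForm_eq_of_isRotated _ h, loopForm_rectanglePath_long_first hij hir hR hT
      fun y hy => hΛ y (h.mem_iff.2 hy)]

theorem norm_wilsonExpectation_le_log {n : ℕ} {G : Subgroup (Matrix.unitaryGroup (Fin n) ℂ)}
    [CompactSpace G] (hG : ∀ z : ℂ, ‖z‖ = 1 → ∃ g ∈ G, (g : Matrix (Fin n) (Fin n) ℂ) = z • 1)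
    {Λ : Finset (Site 3)} {β : ℝ} (hβ : 0 ≤ β) {R T : ℕ} {ℓ : List (Site 3)}
    (hℓ : IsRectangularLoop ℓ R T) (hΛ : ∀ x ∈ ℓ, x ∈ Λ) :
    ‖wilsonExpectation G Λ β ℓ‖ ≤
      n * Real.exp (-(1 / 48 * (1 + n * β)⁻¹ * T * Real.log (R + 1))) := by
  have hnβ : 0 ≤ n * β := by positivity
  set k := (1 + n * β)⁻¹ with hk
  have hk0 : 0 < k := by positivity
  have hk1 : k ≤ 1 := inv_le_one_of_one_le₀ (by linarith)
  have hk2 : n * β * k ≤ 1 := by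
    rw [hk, ← div_eq_mul_inv, div_le_one (by positivity)]
    linarith
  -- With `δ = k/24` the gain is `(k/24)·T·H_R`, and the cost `12nβδ²·T·H_R = nβk·(k/48)·T·H_R` is
  -- at most half of it since `nβk ≤ 1`. What remains is `(k/48)·T·H_R`.
  obtain ⟨a, ha, hsum⟩ := exists_wall hℓ hΛ (δ := k / 24) (by nlinarith)
  refine (norm_wilsonExpectation_le hG a hβ ℓ).trans ?_
  refine mul_le_mul_of_nonneg_left (Real.exp_le_exp.2 ?_) (Nat.cast_nonneg n)
  rw [ha]
  have hlog : Real.log (R + 1) ≤ harmonic R := by exact_mod_cast log_add_one_le_harmonic R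
  have hlog0 : 0 ≤ Real.log (R + 1) := Real.log_nonneg (by simp)
  have h1 := mul_le_mul_of_nonneg_left hsum hnβ
  have h2 : n * β * (12 * (k / 24) ^ 2 * T * harmonic R) ≤ k / 48 * T * harmonic R := by
    have h3 : 0 ≤ k / 48 * T * harmonic R := mul_nonneg (by positivity) (hlog0.trans hlog)
    have := mul_le_mul_of_nonneg_right hk2 h3
    linarith
  have h4 := mul_le_mul_of_nonneg_left hlog (by positivity : 0 ≤ k / 48 * T)
  linarith

end LatticeGauge

theorem theorem1 :
    (∃ C : ℝ, 0 < C ∧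
      ∀ (n : ℕ) (G : Subgroup (Matrix.unitaryGroup (Fin n) ℂ)) [CompactSpace G],
        (∀ z : ℂ, ‖z‖ = 1 → ∃ g ∈ G, (g : Matrix (Fin n) (Fin n) ℂ) = z • 1) →
        ∀ (Λ : Finset (LatticeGauge.Site 3)) (β : ℝ), 0 < β →
        ∀ (R T : ℕ) (ℓ : List (LatticeGauge.Site 3)),
          LatticeGauge.IsRectangularLoop ℓ R T → R ≤ T → (∀ x ∈ ℓ, x ∈ Λ) →
          ‖LatticeGauge.wilsonExpectation G Λ β ℓ‖ ≤
            n * Real.exp (-(C * (1 + n * β)⁻¹ * T * Real.log (R + 1)))) ∧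
    (∀ (n : ℕ) (G : Subgroup (Matrix.unitaryGroup (Fin n) ℂ)) [CompactSpace G],
        (∀ z : ℂ, ‖z‖ = 1 → ∃ g ∈ G, (g : Matrix (Fin n) (Fin n) ℂ) = z • 1) →
        ∀ β : ℝ, 0 < β → LatticeGauge.Confines 3 G β) := by
  refine ⟨⟨1 / 48, by norm_num, fun n G _ hG Λ β hβ R T ℓ hℓ _ hΛ =>
    LatticeGauge.norm_wilsonExpectation_le_log hG hβ.le hℓ hΛ⟩, fun n G _ hG β hβ => ?_⟩
  refine ⟨fun R => 1 / 48 * (1 + n * β)⁻¹ * Real.log (R + 1), ?_, n, fun Λ R T ℓ hℓ _ hΛ => ?_⟩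
  · exact (Real.tendsto_log_atTop.comp (tendsto_atTop_add_const_right _ 1 tendsto_id)).const_mul_atTop
      (by positivity)
  · refine (LatticeGauge.norm_wilsonExpectation_le_log hG hβ.le hℓ hΛ).trans_eq ?_
    rw [mul_right_comm _ (T : ℝ)]
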